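/- Let $N\in\mathbb{N}$, $-\infty\le T_1<T_2\le\infty$ and $S=\{z=(x,t): x\in\mathbb{R}^N,\ T_1<t<T_2\}$. Let $$\mathcal{H}=\sum_{i,j=1}^N q_{i,j}(z)\,\partial^2_{x_ix_j}+\sum_{k=1}^N q_k(z)\,\partial_{x_k}-\partial_t$$ have coefficients $q_{i,j}=q_{j,i}$, $q_k$ in $C^\infty(S)$, with $\sum_{i,j}q_{i,j}(z)v_iv_j\ge 0$ for all $z\in S$, $v\in\mathbb{R}^N$, and $\sum_{i,j}q_{i,j}(z)v_iv_j\not\equiv 0$ in $v$ for every $z\in S$. Assume that $\mathcal{H}$ and its formal adjoint $\mathcal{H}^*$ are hypoelliptic in $S$. Let $\Gamma:S\times S\to\mathbb{R}$, smooth off the diagonal of $S\times S$, be a global fundamental solution of $\mathcal{H}$, in the following sense. (i) For every $\zeta\in S$, $\Gamma(\cdot,\zeta)\in L^1_{\rm loc}(S)$ and $\mathcal{H}\,\Gamma(\cdot,\zeta)=-\delta_\zeta$ in the sense of distributions on $S$; for every $z\in S$, $\Gamma(z,\cdot)\in L^1_{\rm loc}(S)$ and $\mathcal{H}^*\,\Gamma(z,\cdot)=-\delta_z$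 in the sense of distributions on $S$. (ii) For every continuous compactly supported $\varphi:\mathbb{R}^N\to\mathbb{R}$ and every $x_0\in\mathbb{R}^N$, $$\int_{\mathbb{R}^N}\Gamma((x,t),(\xi,\tau))\,\varphi(\xi)\,d\xi\to\varphi(x_0)$$ as $x\to x_0$, $t\searrow\tau$ for every fixed $\tau\in(T_1,T_2)$, and also as $x\to x_0$, $\tau\nearrow t$ for every fixed $t\in(T_1,T_2)$. (iii) There are a distance $d$ on $\mathbb{R}^N$ and constants $0<a_0\le b_0$, $\Lambda\ge 1$ such that $$\frac1\Lambda G_{b_0}(z,\zeta)\le\Gamma(z,\zeta)\le\Lambda G_{a_0}(z,\zeta)\qquad\text{for all } z,\zeta\in S,$$ where, with $B_d(x,r)=\{y: d(x,y)<r\}$ and $|\cdot|$ the Lebesgue measure, $G_a((x,t),(\xi,\tau))=0$ if $t\le\tau$ and $$G_a((x,t),(\xi,\tau))=\frac{1}{|B_d(x,\sqrt{t-\tau})|}\exp\Big(-a\,\frac{d(x,\xi)^2}{t-\tau}\Big)\qquad\text{if } t>\tau.$$ The distance $d$ satisfies: - (D1) the $d$-topology is the Euclidean topology, $(\mathbb{R}^N,d)$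 is complete, and for every fixed $x$, $d(x,\xi)\to\infty$ if and only if $|\xi|\to\infty$; - (D2) there is $c_d>1$ with $|B_d(x,2r)|\le c_d|B_d(x,r)|$ for all $x\in\mathbb{R}^N$, $r>0$; - (D3) for all $x,y\in\mathbb{R}^N$ there is a continuous path $\gamma:[0,1]\to\mathbb{R}^N$ from $x$ to $y$ with $d(x,y)=d(x,\gamma(\sigma))+d(\gamma(\sigma),y)$ for all $\sigma\in[0,1]$. Then, for all $x,y\in\mathbb{R}^N$ and all $T_1<s<\tau<t<T_2$, the function $\xi\mapsto\Gamma((x,t),(\xi,\tau))\,\Gamma((\xi,\tau),(y,s))$ is integrable on $\mathbb{R}^N$ and $$\Gamma((x,t),(y,s))=\int_{\mathbb{R}^N}\Gamma((x,t),(\xi,\tau))\,\Gamma((\xi,\tau),(y,s))\,d\xi .$$ -/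

import Mathlib

open MeasureTheory Filter Topology
open scoped ContDiff Distributions

noncomputable section

namespace EvolutionOperators

/-- The space variable `x ∈ ℝ^N`. -/
abbrev Space (N : ℕ) := EuclideanSpace ℝ (Fin N)

/-- Space-time points `z = (x, t) ∈ ℝ^N × ℝ`. -/
abbrev SpaceTime (N : ℕ) := Space N × ℝ

/-- The strip `S = {(x, t) : T₁ < t < T₂}`, where `T₁` and `T₂` may be infinite. -/
def strip (N : ℕ) (T₁ T₂ : EReal) : TopologicalSpace.Opens (SpaceTime N) where
  carrier := {z | T₁ < (z.2 : EReal) ∧ (z.2 : EReal) < T₂}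
  is_open' :=
    (isOpen_lt continuous_const (continuous_coe_real_ereal.comp continuous_snd)).inter
      (isOpen_lt (continuous_coe_real_ereal.comp continuous_snd) continuous_const)

/-- The partial derivative `∂_{x_i} u`. -/
def dx {N : ℕ} (i : Fin N) (u : SpaceTime N → ℝ) (z : SpaceTime N) : ℝ :=
  fderiv ℝ u z (EuclideanSpace.single i 1, 0)

/-- The partial derivative `∂_t u`. -/
def dt {N : ℕ} (u : SpaceTime N → ℝ) (z : SpaceTime N) : ℝ :=
  fderiv ℝ u z (0, 1)

/-- The data of an operator `∑ q_{ij} ∂²_{x_i x_j} + ∑ q_k ∂_{x_k} - ∂_t` on an open set `S` of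
space-time: the coefficients are smooth in `S`, and the principal part is symmetric, nonnegative
definite and not totally degenerate at every point of `S`. (Values outside `S` are irrelevant.) -/
structure EvolutionOperator (N : ℕ) (S : TopologicalSpace.Opens (SpaceTime N)) where
  /-- second order coefficients `q_{ij}` -/
  a : Fin N → Fin N → SpaceTime N → ℝ
  /-- first order coefficients `q_k` -/
  b : Fin N → SpaceTime N → ℝ
  a_smooth : ∀ i j, ContDiffOn ℝ ∞ (a i j) S
  b_smooth : ∀ k, ContDiffOn ℝ ∞ (b k) S
  a_symm : ∀ z ∈ S, ∀ i j, a i j z = a j i z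
  a_nonneg : ∀ z ∈ S, ∀ v : Fin N → ℝ, 0 ≤ ∑ i, ∑ j, a i j z * v i * v j
  a_nontrivial : ∀ z ∈ S, ∃ v : Fin N → ℝ, ∑ i, ∑ j, a i j z * v i * v j ≠ 0

section Auxiliary

variable {N : ℕ} {S O : TopologicalSpace.Opens (SpaceTime N)}

theorem contDiff_dx {u : SpaceTime N → ℝ} (hu : ContDiff ℝ ∞ u) (i : Fin N) :
    ContDiff ℝ ∞ (dx i u) :=
  (hu.fderiv_right (m := ∞) (by simp)).clm_apply contDiff_const

theorem contDiff_dt {u : SpaceTime N → ℝ} (hu : ContDiff ℝ ∞ u) : ContDiff ℝ ∞ (dt u) :=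
  (hu.fderiv_right (m := ∞) (by simp)).clm_apply contDiff_const

theorem tsupport_dx_subset (u : SpaceTime N → ℝ) (i : Fin N) : tsupport (dx i u) ⊆ tsupport u :=
  tsupport_fderiv_apply_subset ℝ _

theorem tsupport_dt_subset (u : SpaceTime N → ℝ) : tsupport (dt u) ⊆ tsupport u :=
  tsupport_fderiv_apply_subset ℝ _

theorem contDiff_mul_of_tsupport {q u : SpaceTime N → ℝ} (hq : ContDiffOn ℝ ∞ q S)
    (hu : ContDiff ℝ ∞ u) (hS : tsupport u ⊆ S) : ContDiff ℝ ∞ (fun z => q z * u z) := by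
  refine contDiff_iff_contDiffAt.2 fun z => ?_
  by_cases hz : z ∈ tsupport (fun z => q z * u z)
  case neg =>
    exact contDiffAt_const.congr_of_eventuallyEq (notMem_tsupport_iff_eventuallyEq.1 hz)
  have hz' : z ∈ (S : Set (SpaceTime N)) := hS (tsupport_mul_subset_right hz)
  exact (hq.contDiffAt (S.isOpen.mem_nhds hz')).mul hu.contDiffAt

end Auxiliary

namespace EvolutionOperator

variable {N : ℕ} {S : TopologicalSpace.Opens (SpaceTime N)}

/-- `ℋ u = ∑ q_{ij} ∂²_{x_i x_j} u + ∑ q_k ∂_{x_k} u - ∂_t u`. -/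
def op (H : EvolutionOperator N S) (u : SpaceTime N → ℝ) (z : SpaceTime N) : ℝ :=
  (∑ i, ∑ j, H.a i j z * dx i (dx j u) z) + (∑ k, H.b k z * dx k u z) - dt u z

/-- The formal adjoint
`ℋ* u = ∑ ∂²_{x_i x_j} (q_{ij} u) - ∑ ∂_{x_k} (q_k u) + ∂_t u`. -/
def adj (H : EvolutionOperator N S) (u : SpaceTime N → ℝ) (z : SpaceTime N) : ℝ :=
  (∑ i, ∑ j, dx i (dx j (fun w => H.a i j w * u w)) z)
    - (∑ k, dx k (fun w => H.b k w * u w) z) + dt u z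

section Auxiliary

variable (H : EvolutionOperator N S) {u : SpaceTime N → ℝ}

theorem contDiff_op (hu : ContDiff ℝ ∞ u) (hS : tsupport u ⊆ S) : ContDiff ℝ ∞ (H.op u) := by
  refine ContDiff.sub (ContDiff.add ?_ ?_) (contDiff_dt hu)
  · refine ContDiff.sum fun i _ => ContDiff.sum fun j _ => ?_
    exact contDiff_mul_of_tsupport (H.a_smooth i j) (contDiff_dx (contDiff_dx hu j) i)
      (((tsupport_dx_subset _ i).trans (tsupport_dx_subset _ j)).trans hS)
  · refine ContDiff.sum fun k _ => ?_
    exact contDiff_mul_of_tsupport (H.b_smooth k) (contDiff_dx hu k)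
      ((tsupport_dx_subset _ k).trans hS)

theorem contDiff_adj (hu : ContDiff ℝ ∞ u) (hS : tsupport u ⊆ S) : ContDiff ℝ ∞ (H.adj u) := by
  refine ContDiff.add (ContDiff.sub ?_ ?_) (contDiff_dt hu)
  · refine ContDiff.sum fun i _ => ContDiff.sum fun j _ => ?_
    exact contDiff_dx (contDiff_dx (contDiff_mul_of_tsupport (H.a_smooth i j) hu hS) j) i
  · refine ContDiff.sum fun k _ => ?_
    exact contDiff_dx (contDiff_mul_of_tsupport (H.b_smooth k) hu hS) k

theorem tsupport_op_subset : tsupport (H.op u) ⊆ tsupport u := by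
  refine closure_minimal (fun z hz => ?_) (isClosed_tsupport u)
  by_contra h
  refine hz ?_
  have h1 : ∀ k, dx k u z = 0 := fun k =>
    image_eq_zero_of_notMem_tsupport fun h' => h (tsupport_dx_subset _ k h')
  have h2 : ∀ i j, dx i (dx j u) z = 0 := fun i j =>
    image_eq_zero_of_notMem_tsupport fun h' =>
      h (tsupport_dx_subset _ j (tsupport_dx_subset _ i h'))
  have h3 : dt u z = 0 := image_eq_zero_of_notMem_tsupport fun h' => h (tsupport_dt_subset _ h')
  simp [op, h1, h2, h3]

theorem tsupport_adj_subset : tsupport (H.adj u) ⊆ tsupport u := by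
  refine closure_minimal (fun z hz => ?_) (isClosed_tsupport u)
  by_contra h
  refine hz ?_
  have h1 : ∀ k, dx k (fun w => H.b k w * u w) z = 0 := fun k =>
    image_eq_zero_of_notMem_tsupport fun h' =>
      h (tsupport_mul_subset_right (tsupport_dx_subset _ k h'))
  have h2 : ∀ i j, dx i (dx j (fun w => H.a i j w * u w)) z = 0 := fun i j =>
    image_eq_zero_of_notMem_tsupport fun h' =>
      h (tsupport_mul_subset_right (tsupport_dx_subset _ j (tsupport_dx_subset _ i h')))
  have h3 : dt u z = 0 := image_eq_zero_of_notMem_tsupport fun h' => h (tsupport_dt_subset _ h')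
  simp [adj, h1, h2, h3]

end Auxiliary

/-- `ℋ` as a map of test functions on an open set `O ⊆ S`. -/
def opTest (H : EvolutionOperator N S) {O : TopologicalSpace.Opens (SpaceTime N)} (hO : O ≤ S)
    (φ : 𝓓(O, ℝ)) : 𝓓(O, ℝ) :=
  ⟨H.op φ, H.contDiff_op φ.contDiff (φ.tsupport_subset.trans hO),
    φ.hasCompactSupport.of_isClosed_subset (isClosed_tsupport _) H.tsupport_op_subset,
    H.tsupport_op_subset.trans φ.tsupport_subset⟩

/-- `ℋ*` as a map of test functions on an open set `O ⊆ S`. -/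
def adjTest (H : EvolutionOperator N S) {O : TopologicalSpace.Opens (SpaceTime N)} (hO : O ≤ S)
    (φ : 𝓓(O, ℝ)) : 𝓓(O, ℝ) :=
  ⟨H.adj φ, H.contDiff_adj φ.contDiff (φ.tsupport_subset.trans hO),
    φ.hasCompactSupport.of_isClosed_subset (isClosed_tsupport _) H.tsupport_adj_subset,
    H.tsupport_adj_subset.trans φ.tsupport_subset⟩

end EvolutionOperator

/-- The distribution `u` on `O` is (integration against) a smooth function `f` on `O`. -/
def IsSmoothDensity {N : ℕ} {O : TopologicalSpace.Opens (SpaceTime N)} (u : 𝓓'(O, ℝ))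
    (f : SpaceTime N → ℝ) : Prop :=
  ContDiffOn ℝ ∞ f O ∧ ∀ φ : 𝓓(O, ℝ), u φ = ∫ z, f z * φ z

/-- `ℋ` is hypoelliptic in `S`: for every open `O ⊆ S`, a distribution `u` on `O` such that `ℋ u`
(i.e. `φ ↦ u (ℋ* φ)`) is a smooth function on `O` is itself a smooth function on `O`. -/
def EvolutionOperator.Hypoelliptic {N : ℕ} {S : TopologicalSpace.Opens (SpaceTime N)}
    (H : EvolutionOperator N S) : Prop :=
  ∀ (O : TopologicalSpace.Opens (SpaceTime N)) (hO : O ≤ S) (u : 𝓓'(O, ℝ))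
    (f : SpaceTime N → ℝ), ContDiffOn ℝ ∞ f O →
    (∀ φ : 𝓓(O, ℝ), u (H.adjTest hO φ) = ∫ z, f z * φ z) →
    ∃ g : SpaceTime N → ℝ, IsSmoothDensity u g

/-- `ℋ*` is hypoelliptic in `S`; here `ℋ* u` is the distribution `φ ↦ u (ℋ φ)`. -/
def EvolutionOperator.AdjointHypoelliptic {N : ℕ} {S : TopologicalSpace.Opens (SpaceTime N)}
    (H : EvolutionOperator N S) : Prop :=
  ∀ (O : TopologicalSpace.Opens (SpaceTime N)) (hO : O ≤ S) (u : 𝓓'(O, ℝ))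
    (f : SpaceTime N → ℝ), ContDiffOn ℝ ∞ f O →
    (∀ φ : 𝓓(O, ℝ), u (H.opTest hO φ) = ∫ z, f z * φ z) →
    ∃ g : SpaceTime N → ℝ, IsSmoothDensity u g

/-- The ball `B_d(x, r) = {y : d(x, y) < r}`. -/
def dBall {N : ℕ} (d : Space N → Space N → ℝ) (x : Space N) (r : ℝ) : Set (Space N) :=
  {y | d x y < r}

/-- `d` is a distance on `ℝ^N` inducing the Euclidean topology, complete, with `d(x, ξ) → ∞` iff
`ξ → ∞`, doubling with respect to Lebesgue measure, and with the segment property. -/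
structure IsAdmissibleDistance {N : ℕ} (d : Space N → Space N → ℝ) : Prop where
  eq_zero_iff : ∀ x y, d x y = 0 ↔ x = y
  symm : ∀ x y, d x y = d y x
  triangle : ∀ x y w, d x w ≤ d x y + d y w
  isOpen_iff : ∀ U : Set (Space N), IsOpen U ↔ ∀ x ∈ U, ∃ r > 0, dBall d x r ⊆ U
  complete : ∀ u : ℕ → Space N,
    (∀ ε > 0, ∃ n₀, ∀ m ≥ n₀, ∀ n ≥ n₀, d (u m) (u n) < ε) →
    ∃ x, Tendsto (fun n => d (u n) x) atTop (𝓝 0)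
  -- `d(x, ξ) → ∞` if and only if `ξ → ∞` in the Euclidean norm
  comap_atTop : ∀ x, comap (d x) atTop = Bornology.cobounded (Space N)
  doubling : ∃ c : ℝ, 1 < c ∧ ∀ (x : Space N) (r : ℝ), 0 < r →
    volume (dBall d x (2 * r)) ≤ ENNReal.ofReal c * volume (dBall d x r)
  segment : ∀ x y : Space N, ∃ γ : Path x y, ∀ s, d x y = d x (γ s) + d (γ s) y

/-- The Gaussian kernel
`G_a(x,t,ξ,τ) = |B_d(x, √(t-τ))|⁻¹ exp(-a d(x,ξ)² / (t-τ))` for `t > τ`, and `0` for `t ≤ τ`. -/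
def gaussianKernel {N : ℕ} (d : Space N → Space N → ℝ) (a : ℝ) (z ζ : SpaceTime N) : ℝ :=
  if z.2 ≤ ζ.2 then 0
  else 1 / volume.real (dBall d z.1 (Real.sqrt (z.2 - ζ.2)))
    * Real.exp (-(a * (d z.1 ζ.1 ^ 2 / (z.2 - ζ.2))))

/-- The two-sided Gaussian estimates on the strip, with respect to the distance `d`. -/
def HasGaussianBounds {N : ℕ} (S : TopologicalSpace.Opens (SpaceTime N))
    (d : Space N → Space N → ℝ) (Γ : SpaceTime N → SpaceTime N → ℝ) : Prop :=
  ∃ a₀ b₀ Λ : ℝ, 0 < a₀ ∧ a₀ ≤ b₀ ∧ 1 ≤ Λ ∧ ∀ z ∈ S, ∀ ζ ∈ S,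
    1 / Λ * gaussianKernel d b₀ z ζ ≤ Γ z ζ ∧ Γ z ζ ≤ Λ * gaussianKernel d a₀ z ζ

/-- `Γ` is a global fundamental solution of `ℋ` on the strip `T₁ < t < T₂` (two-sided Gaussian
estimates aside): smooth off the diagonal, locally integrable in each variable with
`ℋ Γ(·, ζ) = -δ_ζ` and `ℋ* Γ(z, ·) = -δ_z`, and attaining continuous compactly supported data both
as `t ↘ τ` and as `τ ↗ t`. -/
structure IsFundamentalSolution {N : ℕ} {T₁ T₂ : EReal} (H : EvolutionOperator N (strip N T₁ T₂))
    (Γ : SpaceTime N → SpaceTime N → ℝ) : Prop where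
  smooth : ContDiffOn ℝ ∞ (fun p : SpaceTime N × SpaceTime N => Γ p.1 p.2)
    {p | p.1 ∈ strip N T₁ T₂ ∧ p.2 ∈ strip N T₁ T₂ ∧ p.1 ≠ p.2}
  locallyIntegrable_left : ∀ ζ ∈ strip N T₁ T₂,
    LocallyIntegrableOn (fun z => Γ z ζ) (strip N T₁ T₂)
  op_eq : ∀ ζ ∈ strip N T₁ T₂, ∀ φ : 𝓓(strip N T₁ T₂, ℝ),
    ∫ z, Γ z ζ * H.adj φ z = - φ ζ
  locallyIntegrable_right : ∀ z ∈ strip N T₁ T₂,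
    LocallyIntegrableOn (fun ζ => Γ z ζ) (strip N T₁ T₂)
  adj_eq : ∀ z ∈ strip N T₁ T₂, ∀ φ : 𝓓(strip N T₁ T₂, ℝ),
    ∫ ζ, Γ z ζ * H.op φ ζ = - φ z
  tendsto_forward : ∀ φ : Space N → ℝ, Continuous φ → HasCompactSupport φ →
    ∀ (x₀ : Space N) (τ : ℝ), T₁ < (τ : EReal) → (τ : EReal) < T₂ →
      Tendsto (fun p : Space N × ℝ => ∫ ξ, Γ (p.1, p.2) (ξ, τ) * φ ξ)
        (𝓝 x₀ ×ˢ 𝓝[>] τ) (𝓝 (φ x₀))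
  tendsto_backward : ∀ φ : Space N → ℝ, Continuous φ → HasCompactSupport φ →
    ∀ (x₀ : Space N) (t : ℝ), T₁ < (t : EReal) → (t : EReal) < T₂ →
      Tendsto (fun p : Space N × ℝ => ∫ ξ, Γ (p.1, t) (ξ, p.2) * φ ξ)
        (𝓝 x₀ ×ˢ 𝓝[<] t) (𝓝 (φ x₀))

end EvolutionOperators

end

namespace EvolutionOperators

variable {N : ℕ}

/-- The regularity used in the maximum principle: `u` and all its first order space derivatives are
differentiable on `O`. -/
structure TwiceDifferentiableOn (u : SpaceTime N → ℝ) (O : Set (SpaceTime N)) : Prop where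
  differentiableAt : ∀ z ∈ O, DifferentiableAt ℝ u z
  differentiableAt_dx : ∀ i, ∀ z ∈ O, DifferentiableAt ℝ (dx i u) z

theorem fderiv_space_direction (u : SpaceTime N → ℝ) (z : SpaceTime N) (e : Space N) :
    fderiv ℝ u z (e, 0) = ∑ j, e j * dx j u z := by
  have h : ((e, 0) : SpaceTime N)
      = ∑ j, e j • ((EuclideanSpace.single j (1 : ℝ), 0) : SpaceTime N) := by
    refine Prod.ext ?_ (by simp [Prod.snd_sum])
    ext k
    simp [Prod.fst_sum, Finset.sum_apply, Pi.single_apply]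
  rw [h, map_sum]
  simp only [map_smul, smul_eq_mul, dx]

theorem hasDerivAt_comp_space_line {u : SpaceTime N → ℝ} {x e : Space N} {t h : ℝ}
    (hu : DifferentiableAt ℝ u (x + h • e, t)) :
    HasDerivAt (fun h : ℝ => u (x + h • e, t)) (∑ j, e j * dx j u (x + h • e, t)) h := by
  rw [← fderiv_space_direction]
  have h1 : HasDerivAt (fun h : ℝ => ((x + h • e, t) : SpaceTime N)) (e, 0) h := by
    refine HasDerivAt.prodMk ?_ (hasDerivAt_const _ _)
    simpa using ((hasDerivAt_id h).smul_const e).const_add x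
  exact hu.hasFDerivAt.comp_hasDerivAt h h1

theorem hasDerivAt_comp_time_line {u : SpaceTime N → ℝ} {x : Space N} {t : ℝ}
    (hu : DifferentiableAt ℝ u (x, t)) : HasDerivAt (fun t : ℝ => u (x, t)) (dt u (x, t)) t :=
  hu.hasFDerivAt.comp_hasDerivAt t ((hasDerivAt_const _ _).prodMk (hasDerivAt_id t))

theorem dx_eq_zero_of_isLocalMax {u : SpaceTime N → ℝ} {x : Space N} {t : ℝ}
    (hu : DifferentiableAt ℝ u (x, t)) (hmax : IsLocalMax (fun x' => u (x', t)) x) (i : Fin N) :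
    dx i u (x, t) = 0 := by
  have h1 : HasFDerivAt (fun x' : Space N => ((x', t) : SpaceTime N))
      (ContinuousLinearMap.inl ℝ (Space N) ℝ) x := hasFDerivAt_prodMk_left x t
  have h2 := hmax.hasFDerivAt_eq_zero (hu.hasFDerivAt.comp x h1)
  simpa [dx] using DFunLike.congr_fun h2 (EuclideanSpace.single i (1 : ℝ))

/-- The second derivative along a line is nonpositive at a local maximum. -/
theorem deriv_deriv_nonpos_of_isLocalMax {g : ℝ → ℝ} {x : ℝ} (hg : ContinuousAt g x)
    (hmax : IsLocalMax g x) : deriv (deriv g) x ≤ 0 := by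
  by_contra! h
  have hmin : IsLocalMin g x := isLocalMin_of_deriv_deriv_pos h hmax.deriv_eq_zero hg
  have hc : g =ᶠ[𝓝 x] fun _ => g x := by
    filter_upwards [hmax, hmin] with y h1 h2 using le_antisymm h1 h2
  have : deriv (deriv g) x = 0 := by
    rw [hc.deriv.deriv_eq]
    simp
  exact h.ne' this

theorem sum_dx_dx_nonpos_of_isLocalMax {u : SpaceTime N → ℝ} {O : Set (SpaceTime N)}
    (hO : IsOpen O) (hu : TwiceDifferentiableOn u O) {x : Space N} {t : ℝ} (hz : (x, t) ∈ O)
    (hmax : IsLocalMax (fun x' => u (x', t)) x) (v : Fin N → ℝ) :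
    ∑ i, ∑ j, dx i (dx j u) (x, t) * v i * v j ≤ 0 := by
  set e : Space N := WithLp.toLp 2 v
  have hc : Continuous fun h : ℝ => ((x + h • e, t) : SpaceTime N) := by fun_prop
  have hcx : Tendsto (fun h : ℝ => x + h • e) (𝓝 0) (𝓝 x) := by
    have : Continuous fun h : ℝ => x + h • e := by fun_prop
    simpa using this.tendsto 0
  have hev : ∀ᶠ h : ℝ in 𝓝 0, (x + h • e, t) ∈ O := by
    refine hc.continuousAt.eventually_mem (hO.mem_nhds ?_)
    simpa using hz
  set g : ℝ → ℝ := fun h => u (x + h • e, t)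
  have hg1 : deriv g =ᶠ[𝓝 0] fun h => ∑ j, e j * dx j u (x + h • e, t) := by
    filter_upwards [hev] with h hh
    exact (hasDerivAt_comp_space_line (hu.differentiableAt _ hh)).deriv
  have hg2 : deriv (deriv g) 0 = ∑ j, e j * ∑ i, e i * dx i (dx j u) (x, t) := by
    rw [hg1.deriv_eq]
    refine HasDerivAt.deriv (HasDerivAt.fun_sum fun j _ => HasDerivAt.const_mul _ ?_)
    have := hasDerivAt_comp_space_line (u := dx j u) (x := x) (e := e) (t := t) (h := 0)
      (by simpa using hu.differentiableAt_dx j _ hz)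
    simpa using this
  have hgc : ContinuousAt g 0 :=
    (hasDerivAt_comp_space_line (hu.differentiableAt _ (by simpa using hz))).continuousAt
  have hgm : IsLocalMax g 0 := by
    have := hcx.eventually hmax
    simpa [IsLocalMax, IsMaxFilter, g] using this
  have h := deriv_deriv_nonpos_of_isLocalMax hgc hgm
  rw [hg2] at h
  refine le_of_eq_of_le ?_ h
  rw [Finset.sum_comm]
  refine Finset.sum_congr rfl fun j _ => ?_
  rw [Finset.mul_sum]
  refine Finset.sum_congr rfl fun i _ => ?_
  simp only [e]
  ring

/-- The entrywise pairing of a positive semidefinite with a negative semidefinite form is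
nonpositive. -/
theorem sum_mul_nonpos_of_psd {A M : Fin N → Fin N → ℝ} (hs : ∀ i j, A i j = A j i)
    (hA : ∀ v : Fin N → ℝ, 0 ≤ ∑ i, ∑ j, A i j * v i * v j)
    (hM : ∀ v : Fin N → ℝ, ∑ i, ∑ j, M i j * v i * v j ≤ 0) :
    ∑ i, ∑ j, A i j * M i j ≤ 0 := by
  have hP : (Matrix.of A).PosSemidef := by
    rw [Matrix.posSemidef_iff_dotProduct_mulVec]
    refine ⟨by ext i j; simp [hs], fun v => ?_⟩
    refine (hA v).trans_eq ?_
    simp only [dotProduct, Matrix.mulVec, Finset.mul_sum]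
    refine Finset.sum_congr rfl fun i _ => Finset.sum_congr rfl fun j _ => ?_
    simp
    ring
  obtain ⟨B, hB⟩ : ∃ B : Matrix (Fin N) (Fin N) ℝ, Matrix.of A = star B * B := by
    open scoped MatrixOrder Matrix.Norms.L2Operator in
    exact CStarAlgebra.nonneg_iff_eq_star_mul_self.mp hP.nonneg
  have hAB : ∀ i j, A i j = ∑ k, B k i * B k j := fun i j => by
    have := congrFun (congrFun hB i) j
    simpa [Matrix.mul_apply, Matrix.star_eq_conjTranspose] using this
  calc ∑ i, ∑ j, A i j * M i j
      = ∑ k, ∑ i, ∑ j, M i j * B k i * B k j := by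
        symm
        rw [Finset.sum_comm]
        refine Finset.sum_congr rfl fun i _ => ?_
        rw [Finset.sum_comm]
        refine Finset.sum_congr rfl fun j _ => ?_
        rw [hAB, Finset.sum_mul]
        exact Finset.sum_congr rfl fun k _ => by ring
    _ ≤ 0 := Finset.sum_nonpos fun k _ => hM (B k)

/-- Weak maximum principle on a strip, with Cauchy data attained in the `limsup` sense and with a
bound at infinity. -/
theorem weak_maximum_principle {T₁ T₂ : EReal} (H : EvolutionOperator N (strip N T₁ T₂))
    {τ t₁ ε : ℝ} (hτ : T₁ ≤ (τ : EReal)) (ht₁ : (t₁ : EReal) < T₂) {W : SpaceTime N → ℝ}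
    (hW : TwiceDifferentiableOn W (strip N τ T₂)) (hop : ∀ z ∈ strip N τ T₂, 0 ≤ H.op W z)
    (hdata : ∀ x₀, ∀ c > ε, ∀ᶠ p in 𝓝 x₀ ×ˢ 𝓝[>] τ, W p ≤ c)
    (hinf : ∀ᶠ x in Bornology.cobounded (Space N), ∀ t ∈ Set.Ioc τ t₁, W (x, t) ≤ ε)
    (x₁ : Space N) {t₂ : ℝ} (ht₂ : t₂ ∈ Set.Ioc τ t₁) : W (x₁, t₂) ≤ ε := by
  by_contra! hlt
  have hmem : ∀ {x : Space N} {t : ℝ}, t ∈ Set.Ioc τ t₁ → ((x, t) : SpaceTime N) ∈ strip N τ T₂ :=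
    fun {x t} ht => ⟨EReal.coe_lt_coe_iff.2 ht.1, (EReal.coe_le_coe_iff.2 ht.2).trans_lt ht₁⟩
  have hsub : ∀ z ∈ strip N τ T₂, z ∈ strip N T₁ T₂ := fun z hz => ⟨hτ.trans_lt hz.1, hz.2⟩
  obtain ⟨η, hη, hηlt⟩ : ∃ η > 0, ε < W (x₁, t₂) - η * (t₂ - τ) := by
    have hpos : 0 < t₂ - τ := sub_pos.2 ht₂.1
    refine ⟨(W (x₁, t₂) - ε) / 2 / (t₂ - τ), by have := sub_pos.2 hlt; positivity, ?_⟩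
    rw [div_mul_cancel₀ _ hpos.ne']
    linarith
  set V : SpaceTime N → ℝ := fun z => W z - η * (z.2 - τ) with hV
  obtain ⟨c, hεc, hcV⟩ := exists_between hηlt
  obtain ⟨R, -, hR⟩ := (Metric.hasBasis_cobounded_compl_closedBall (0 : Space N)).eventually_iff.1 hinf
  have hK : IsCompact (Metric.closedBall (0 : Space N) R) := isCompact_closedBall _ _
  have hnear : ∀ᶠ t in 𝓝[>] τ, ∀ x ∈ Metric.closedBall (0 : Space N) R, W (x, t) ≤ c := by
    have h1 : {p : SpaceTime N | W p ≤ c} ∈ 𝓝ˢ (Metric.closedBall (0 : Space N) R) ×ˢ 𝓝[>] τ :=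
      hK.mem_nhdsSet_prod_of_forall fun x _ => hdata x c hεc
    obtain ⟨pa, hpa, pb, hpb, hp⟩ := Filter.eventually_prod_iff.1 (show ∀ᶠ p in _, _ from h1)
    filter_upwards [hpb] with t ht x hx
    exact hp (hpa.self_of_nhdsSet x hx) ht
  obtain ⟨δ, hδτ, hδ⟩ := mem_nhdsGT_iff_exists_Ioc_subset.1
    (hnear.and (Ioc_mem_nhdsGT ht₂.1))
  have hδ₂ : δ ≤ t₂ := (hδ ⟨hδτ, le_rfl⟩).2.2
  have hx₁ : x₁ ∈ Metric.closedBall (0 : Space N) R := by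
    by_contra h
    exact (hR h t₂ ht₂).not_gt hlt
  have hIcc : ∀ {t}, t ∈ Set.Icc δ t₁ → t ∈ Set.Ioc τ t₁ := fun ht => ⟨hδτ.trans_le ht.1, ht.2⟩
  obtain ⟨⟨xq, tq⟩, ⟨hxq, htq⟩, hq⟩ :=
    (hK.prod (isCompact_Icc (a := δ) (b := t₁))).exists_isMaxOn (f := V)
      ⟨(x₁, t₂), hx₁, hδ₂, ht₂.2⟩ (fun z hz =>
        ((hW.differentiableAt z (hmem (hIcc hz.2))).continuousAt.sub
          (by fun_prop)).continuousWithinAt)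
  have hVq : c < V (xq, tq) := hcV.trans_le (hq (a := (x₁, t₂)) ⟨hx₁, hδ₂, ht₂.2⟩)
  have htq' := hIcc htq
  have hVW : ∀ x t, t ∈ Set.Ioc τ t₁ → V (x, t) ≤ W (x, t) := fun x t ht => by
    have := mul_nonneg hη.le (sub_nonneg.2 ht.1.le)
    simp only [hV]
    linarith
  have hglob : ∀ x t, t ∈ Set.Ioc τ t₁ → V (x, t) ≤ V (xq, tq) := fun x t ht => by
    by_cases hx : x ∈ Metric.closedBall (0 : Space N) R
    · by_cases hδt : δ ≤ t
      · exact hq (a := (x, t)) ⟨hx, hδt, ht.2⟩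
      · exact ((hVW x t ht).trans ((hδ ⟨ht.1, (not_le.1 hδt).le⟩).1 x hx)).trans hVq.le
    · exact ((hVW x t ht).trans (hR hx t ht)).trans (hεc.trans hVq).le
  have hzO := hmem (x := xq) htq'
  have hmaxx : IsLocalMax (fun x => W (x, tq)) xq := .of_forall fun x => by
    have := hglob x tq htq'
    simp only [hV] at this
    linarith
  have hdt : η ≤ dt W (xq, tq) := by
    have hd : HasDerivAt (fun t => V (xq, t)) (dt W (xq, tq) - η) tq := by
      have := ((hasDerivAt_id tq).sub_const τ).const_mul η
      rw [mul_one] at this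
      exact (hasDerivAt_comp_time_line (hW.differentiableAt _ hzO)).sub this
    refine sub_nonneg.1 (ge_of_tendsto ((hasDerivWithinAt_iff_tendsto_slope'
      (Set.self_notMem_Iio (a := tq))).1 hd.hasDerivWithinAt) ?_)
    filter_upwards [Ioo_mem_nhdsLT htq'.1] with t ht
    rw [slope_def_field]
    exact div_nonneg_of_nonpos (sub_nonpos.2 (hglob xq t ⟨ht.1, ht.2.le.trans htq'.2⟩))
      (sub_nonpos.2 ht.2.le)
  have hH := hop _ hzO
  have h2 := sum_mul_nonpos_of_psd (H.a_symm _ (hsub _ hzO)) (H.a_nonneg _ (hsub _ hzO))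
    (sum_dx_dx_nonpos_of_isLocalMax (strip N τ T₂).isOpen hW hzO hmaxx)
  simp only [EvolutionOperator.op, dx_eq_zero_of_isLocalMax (hW.differentiableAt _ hzO) hmaxx,
    mul_zero, Finset.sum_const_zero] at hH
  linarith

section Germs

variable {u w : SpaceTime N → ℝ} {z : SpaceTime N}

theorem _root_.Filter.EventuallyEq.dx (h : u =ᶠ[𝓝 z] w) (i : Fin N) : dx i u =ᶠ[𝓝 z] dx i w := by
  filter_upwards [h.fderiv (𝕜 := ℝ)] with y hy
  simp only [EvolutionOperators.dx, hy]

theorem EvolutionOperator.op_congr {S : TopologicalSpace.Opens (SpaceTime N)}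
    (H : EvolutionOperator N S) (h : u =ᶠ[𝓝 z] w) : H.op u z = H.op w z := by
  have h1 : ∀ i, dx i u z = dx i w z := fun i => (h.dx i).eq_of_nhds
  have h2 : ∀ i j, dx i (dx j u) z = dx i (dx j w) z := fun i j => ((h.dx j).dx i).eq_of_nhds
  have h3 : dt u z = dt w z := by simp only [dt, h.fderiv_eq]
  simp only [op, h1, h2, h3]

end Germs

instance : (volume : Measure (SpaceTime N)).IsAddHaarMeasure :=
  Measure.prod.instIsAddHaarMeasure (volume : Measure (Space N)) (volume : Measure ℝ)

theorem integral_mul_fderiv_eq {u φ : SpaceTime N → ℝ} (hu : ContDiff ℝ ∞ u)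
    (hφ : ContDiff ℝ ∞ φ) (hc : HasCompactSupport φ) (v : SpaceTime N) :
    ∫ z, u z * fderiv ℝ φ z v = - ∫ z, fderiv ℝ u z v * φ z := by
  have hu' : Continuous fun z => fderiv ℝ u z v :=
    ((hu.fderiv_right (m := ∞) (by simp)).clm_apply contDiff_const).continuous
  have hφ' : Continuous fun z => fderiv ℝ φ z v :=
    ((hφ.fderiv_right (m := ∞) (by simp)).clm_apply contDiff_const).continuous
  refine integral_mul_fderiv_eq_neg_fderiv_mul_of_integrable ?_ ?_ ?_
    (fun z _ => hu.differentiable (by simp) z) (fun z _ => hφ.differentiable (by simp) z)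
  · exact (hu'.mul hφ.continuous).integrable_of_hasCompactSupport hc.mul_left
  · exact (hu.continuous.mul hφ').integrable_of_hasCompactSupport (hc.fderiv_apply ℝ v).mul_left
  · exact (hu.continuous.mul hφ.continuous).integrable_of_hasCompactSupport hc.mul_left

/-- `ℋ*` is the formal adjoint of `ℋ`. -/
theorem EvolutionOperator.integral_mul_adj {S : TopologicalSpace.Opens (SpaceTime N)}
    (H : EvolutionOperator N S) {u φ : SpaceTime N → ℝ} (hu : ContDiff ℝ ∞ u)
    (hφ : ContDiff ℝ ∞ φ) (hc : HasCompactSupport φ) (hφS : tsupport φ ⊆ S) :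
    ∫ z, u z * H.adj φ z = ∫ z, H.op u z * φ z := by
  have hca : ∀ i j, HasCompactSupport fun w => H.a i j w * φ w := fun i j => hc.mul_left
  have hcb : ∀ k, HasCompactSupport fun w => H.b k w * φ w := fun k => hc.mul_left
  have ha := fun i j => contDiff_mul_of_tsupport (H.a_smooth i j) hφ hφS
  have hb := fun k => contDiff_mul_of_tsupport (H.b_smooth k) hφ hφS
  have hcd : ∀ {ψ : SpaceTime N → ℝ} (i : Fin N), HasCompactSupport ψ →
      HasCompactSupport (dx i ψ) := fun i h => h.fderiv_apply ℝ _
  have int : ∀ {v ψ : SpaceTime N → ℝ}, ContDiff ℝ ∞ v → ContDiff ℝ ∞ ψ → HasCompactSupport ψ →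
      Integrable fun z => v z * ψ z := fun hv hψ hcψ =>
    (hv.continuous.mul hψ.continuous).integrable_of_hasCompactSupport hcψ.mul_left
  have ia : ∀ i j, Integrable fun z => u z * dx i (dx j fun w => H.a i j w * φ w) z := fun i j =>
    int hu (contDiff_dx (contDiff_dx (ha i j) j) i) (hcd i (hcd j (hca i j)))
  have ib : ∀ k, Integrable fun z => u z * dx k (fun w => H.b k w * φ w) z := fun k =>
    int hu (contDiff_dx (hb k) k) (hcd k (hcb k))
  have it : Integrable fun z => u z * dt φ z :=
    int hu (contDiff_dt hφ) (hc.fderiv_apply ℝ _)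
  have ja : ∀ i j, Integrable fun z => dx j (dx i u) z * (H.a i j z * φ z) := fun i j =>
    int (contDiff_dx (contDiff_dx hu i) j) (ha i j) (hca i j)
  have jb : ∀ k, Integrable fun z => dx k u z * (H.b k z * φ z) := fun k =>
    int (contDiff_dx hu k) (hb k) (hcb k)
  have jt : Integrable fun z => dt u z * φ z := int (contDiff_dt hu) hφ hc
  have ea : ∀ i j, ∫ z, u z * dx i (dx j fun w => H.a i j w * φ w) z
      = ∫ z, dx j (dx i u) z * (H.a i j z * φ z) := fun i j => by
    have h1 := integral_mul_fderiv_eq hu (contDiff_dx (ha i j) j) (hcd j (hca i j))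
      (EuclideanSpace.single i 1, 0)
    have h2 := integral_mul_fderiv_eq (contDiff_dx hu i) (ha i j) (hca i j)
      (EuclideanSpace.single j 1, 0)
    exact h1.trans (by rw [neg_eq_iff_eq_neg]; exact h2)
  have eb : ∀ k, ∫ z, u z * dx k (fun w => H.b k w * φ w) z
      = - ∫ z, dx k u z * (H.b k z * φ z) := fun k => integral_mul_fderiv_eq hu (hb k) (hcb k) _
  have et : ∫ z, u z * dt φ z = - ∫ z, dt u z * φ z := integral_mul_fderiv_eq hu hφ hc _
  have lhs : ∫ z, u z * H.adj φ z
      = ∑ i, ∑ j, (∫ z, u z * dx i (dx j fun w => H.a i j w * φ w) z)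
        - (∑ k, ∫ z, u z * dx k (fun w => H.b k w * φ w) z) + ∫ z, u z * dt φ z := by
    have hia := integrable_finsetSum Finset.univ fun i _ =>
      integrable_finsetSum Finset.univ fun j _ => ia i j
    have hib := integrable_finsetSum Finset.univ fun k _ => ib k
    rw [← integral_finsetSum _ fun k _ => ib k]
    simp_rw [← integral_finsetSum _ fun j _ => ia _ j]
    rw [← integral_finsetSum _ fun i _ => integrable_finsetSum _ fun j _ => ia i j,
      ← integral_sub hia hib, ← integral_add (by exact hia.sub hib) it]
    refine integral_congr_ae (.of_forall fun z => ?_)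
    simp only [adj, mul_add, mul_sub, Finset.mul_sum]
  have rhs : ∫ z, H.op u z * φ z
      = ∑ i, ∑ j, (∫ z, dx j (dx i u) z * (H.a i j z * φ z))
        + (∑ k, ∫ z, dx k u z * (H.b k z * φ z)) - ∫ z, dt u z * φ z := by
    have hia := integrable_finsetSum Finset.univ fun i _ =>
      integrable_finsetSum Finset.univ fun j _ => ja i j
    have hib := integrable_finsetSum Finset.univ fun k _ => jb k
    rw [← integral_finsetSum _ fun k _ => jb k]
    simp_rw [← integral_finsetSum _ fun j _ => ja _ j]
    rw [← integral_finsetSum _ fun i _ => integrable_finsetSum _ fun j _ => ja i j,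
      ← integral_add hia hib, ← integral_sub (by exact hia.add hib) jt]
    refine integral_congr_ae (.of_forall fun z => ?_)
    by_cases hz : z ∈ S
    · have hsum : ∑ i, ∑ j, dx j (dx i u) z * (H.a i j z * φ z)
          = (∑ i, ∑ j, H.a i j z * dx i (dx j u) z) * φ z := by
        rw [Finset.sum_comm, Finset.sum_mul]
        refine Finset.sum_congr rfl fun i _ => ?_
        rw [Finset.sum_mul]
        refine Finset.sum_congr rfl fun j _ => ?_
        rw [H.a_symm z hz j i]
        ring
      simp only [op, hsum, sub_mul, add_mul, Finset.sum_mul]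
      congr 2
      exact Finset.sum_congr rfl fun k _ => by ring
    · have : φ z = 0 := image_eq_zero_of_notMem_tsupport fun h => hz (hφS h)
      simp [this]
  rw [lhs, rhs]
  simp only [ea, eb, et, Finset.sum_neg_distrib]
  ring

/-- A smooth function annihilated by `ℋ` in the sense of distributions is a classical solution. -/
theorem EvolutionOperator.op_eq_zero_of_distributional {S : TopologicalSpace.Opens (SpaceTime N)}
    (H : EvolutionOperator N S) {O : Set (SpaceTime N)} (hO : IsOpen O) (hOS : O ⊆ S)
    {u : SpaceTime N → ℝ} (hu : ContDiffOn ℝ ∞ u O)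
    (hd : ∀ φ : 𝓓(S, ℝ), tsupport φ ⊆ O → ∫ z, u z * H.adj φ z = 0)
    {z₀ : SpaceTime N} (hz₀ : z₀ ∈ O) : H.op u z₀ = 0 := by
  obtain ⟨r, hr, hrO⟩ := Metric.nhds_basis_closedBall.mem_iff.1 (hO.mem_nhds hz₀)
  let χ : ContDiffBump z₀ := ⟨r / 2, r, by positivity, by linarith⟩
  have hχO : tsupport χ ⊆ O := by rw [χ.tsupport_eq]; exact hrO
  set v : SpaceTime N → ℝ := fun z => u z * χ z with hv
  have hvs : ContDiff ℝ ∞ v :=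
    contDiff_mul_of_tsupport (S := ⟨O, hO⟩) hu χ.contDiff hχO
  have hvc : HasCompactSupport v := χ.hasCompactSupport.mul_left
  have hvS : tsupport v ⊆ S := (tsupport_mul_subset_right.trans hχO).trans hOS
  set B := Metric.ball z₀ (r / 2)
  have hBO : B ⊆ O := (Metric.ball_subset_closedBall.trans
    (Metric.closedBall_subset_closedBall (by linarith))).trans hrO
  have hvu : ∀ z ∈ B, v z = u z := fun z hz => by
    simp [hv, χ.one_of_mem_closedBall (Metric.ball_subset_closedBall hz)]
  have hcont : Continuous (H.op v) := (H.contDiff_op hvs hvS).continuous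
  have hae := Metric.isOpen_ball.ae_eq_zero_of_integral_contDiff_smul_eq_zero (U := B) (f := H.op v)
    (μ := volume) (hcont.locallyIntegrable.locallyIntegrableOn _) fun φ hφ hφc hφB => by
      have hφS : tsupport φ ⊆ S := (hφB.trans hBO).trans hOS
      have h1 : ∫ z, v z * H.adj φ z = 0 := by
        rw [← hd ⟨φ, hφ, hφc, hφS⟩ (hφB.trans hBO)]
        refine integral_congr_ae (.of_forall fun z => ?_)
        by_cases hz : z ∈ B
        · simp only [hvu z hz]; rfl
        · have : H.adj φ z = 0 := image_eq_zero_of_notMem_tsupport fun h =>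
            hz (hφB (H.tsupport_adj_subset h))
          change v z * H.adj φ z = u z * H.adj φ z
          simp [this]
      rw [H.integral_mul_adj hvs hφ hφc hφS] at h1
      simpa [mul_comm] using h1
  have hz₀B : z₀ ∈ B := Metric.mem_ball_self (by positivity)
  have hv0 : H.op v z₀ = 0 := by
    by_contra hne
    have hopen : IsOpen (B ∩ {z | H.op v z ≠ 0}) :=
      Metric.isOpen_ball.inter (isOpen_ne_fun hcont continuous_const)
    refine (hopen.measure_pos volume ⟨z₀, hz₀B, hne⟩).ne' ?_
    refine measure_mono_null (fun z hz => ?_) (ae_iff.1 hae)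
    exact fun h => hz.2 (h hz.1)
  rw [← hv0]
  exact H.op_congr (Filter.eventuallyEq_of_mem (Metric.isOpen_ball.mem_nhds hz₀B)
    fun z hz => (hvu z hz).symm)

section Linearity

variable {u w : SpaceTime N → ℝ} {O : Set (SpaceTime N)}

theorem TwiceDifferentiableOn.of_contDiffOn (hO : IsOpen O) (hu : ContDiffOn ℝ ∞ u O) :
    TwiceDifferentiableOn u O where
  differentiableAt z hz := (hu.contDiffAt (hO.mem_nhds hz)).differentiableAt (by simp)
  differentiableAt_dx i z hz :=
    ((((hu.fderiv_of_isOpen hO (m := ∞) (by simp)).clm_apply contDiffOn_const).contDiffAt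
      (hO.mem_nhds hz)).differentiableAt (by simp) :)

theorem dx_sub {z : SpaceTime N} (hu : DifferentiableAt ℝ u z) (hw : DifferentiableAt ℝ w z)
    (i : Fin N) : dx i (fun z => u z - w z) z = dx i u z - dx i w z := by
  simp [dx, fderiv_fun_sub hu hw]

theorem TwiceDifferentiableOn.dx_sub_eventuallyEq (hO : IsOpen O) (hu : TwiceDifferentiableOn u O)
    (hw : TwiceDifferentiableOn w O) {z : SpaceTime N} (hz : z ∈ O) (i : Fin N) :
    dx i (fun z => u z - w z) =ᶠ[𝓝 z] fun z => dx i u z - dx i w z := by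
  filter_upwards [hO.mem_nhds hz] with y hy
  exact dx_sub (hu.differentiableAt y hy) (hw.differentiableAt y hy) i

theorem TwiceDifferentiableOn.sub (hO : IsOpen O) (hu : TwiceDifferentiableOn u O)
    (hw : TwiceDifferentiableOn w O) : TwiceDifferentiableOn (fun z => u z - w z) O where
  differentiableAt z hz := (hu.differentiableAt z hz).sub (hw.differentiableAt z hz)
  differentiableAt_dx i z hz :=
    ((hu.differentiableAt_dx i z hz).sub (hw.differentiableAt_dx i z hz)).congr_of_eventuallyEq
      (hu.dx_sub_eventuallyEq hO hw hz i)

theorem EvolutionOperator.op_sub {S : TopologicalSpace.Opens (SpaceTime N)}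
    (H : EvolutionOperator N S) (hO : IsOpen O) (hu : TwiceDifferentiableOn u O)
    (hw : TwiceDifferentiableOn w O) {z : SpaceTime N} (hz : z ∈ O) :
    H.op (fun z => u z - w z) z = H.op u z - H.op w z := by
  have h1 : ∀ k, dx k (fun z => u z - w z) z = dx k u z - dx k w z :=
    dx_sub (hu.differentiableAt z hz) (hw.differentiableAt z hz)
  have h2 : ∀ i j, dx i (dx j fun z => u z - w z) z = dx i (dx j u) z - dx i (dx j w) z :=
    fun i j => by
      rw [((hu.dx_sub_eventuallyEq hO hw hz j).dx i).eq_of_nhds]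
      exact dx_sub (hu.differentiableAt_dx j z hz) (hw.differentiableAt_dx j z hz) i
  have h3 : dt (fun z => u z - w z) z = dt u z - dt w z := by
    simp [dt, fderiv_fun_sub (hu.differentiableAt z hz) (hw.differentiableAt z hz)]
  simp only [op, h1, h2, h3, mul_sub, Finset.sum_sub_distrib]
  ring

end Linearity

section ParametricIntegral

variable {F : SpaceTime N → Space N → ℝ} {O : Set (SpaceTime N)} {φ : Space N → ℝ}

theorem hasFDerivAt_slice (hO : IsOpen O)
    (hF : ContDiffOn ℝ ∞ (fun p : SpaceTime N × Space N => F p.1 p.2) (O ×ˢ Set.univ))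
    {z : SpaceTime N} (hz : z ∈ O) (ξ : Space N) :
    HasFDerivAt (fun z => F z ξ)
      ((fderiv ℝ (fun p : SpaceTime N × Space N => F p.1 p.2) (z, ξ)).comp
        (ContinuousLinearMap.inl ℝ _ _)) z := by
  have h1 : DifferentiableAt ℝ (fun p : SpaceTime N × Space N => F p.1 p.2) (z, ξ) :=
    (hF.contDiffAt ((hO.prod isOpen_univ).mem_nhds ⟨hz, trivial⟩)).differentiableAt (by simp)
  exact HasFDerivAt.comp (f := fun z : SpaceTime N => (z, ξ)) z h1.hasFDerivAt
    (hasFDerivAt_prodMk_left z ξ)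

theorem contDiffOn_fderiv_slice (hO : IsOpen O)
    (hF : ContDiffOn ℝ ∞ (fun p : SpaceTime N × Space N => F p.1 p.2) (O ×ˢ Set.univ)) :
    ContDiffOn ℝ ∞ (fun p : SpaceTime N × Space N => fderiv ℝ (fun z => F z p.2) p.1)
      (O ×ˢ Set.univ) := by
  refine ((hF.fderiv_of_isOpen (hO.prod isOpen_univ) (m := ∞) (by simp)).clm_comp
    (contDiffOn_const (c := ContinuousLinearMap.inl ℝ (SpaceTime N) (Space N)))).congr
    fun p hp => ?_
  exact (hasFDerivAt_slice hO hF hp.1 p.2).fderiv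

theorem integrable_slice_smul {E : Type*} [NormedAddCommGroup E] [NormedSpace ℝ E]
    {G : SpaceTime N → Space N → E}
    (hG : ContinuousOn (fun p : SpaceTime N × Space N => G p.1 p.2) (O ×ˢ Set.univ))
    (hφ : Continuous φ) (hc : HasCompactSupport φ) {z : SpaceTime N} (hz : z ∈ O) :
    Continuous (G z) ∧ Integrable fun ξ => φ ξ • G z ξ := by
  have hGz : Continuous (G z) :=
    hG.comp_continuous (f := fun ξ => (z, ξ)) (by fun_prop) fun ξ => ⟨hz, trivial⟩
  exact ⟨hGz, (hφ.smul hGz).integrable_of_hasCompactSupport hc.smul_right⟩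

theorem hasFDerivAt_integral_slice (hO : IsOpen O)
    (hF : ContDiffOn ℝ ∞ (fun p : SpaceTime N × Space N => F p.1 p.2) (O ×ˢ Set.univ))
    (hφ : Continuous φ) (hc : HasCompactSupport φ) {z : SpaceTime N} (hz : z ∈ O) :
    HasFDerivAt (fun z => ∫ ξ, φ ξ * F z ξ) (∫ ξ, φ ξ • fderiv ℝ (fun z => F z ξ) z) z := by
  have hF' := (contDiffOn_fderiv_slice hO hF).continuousOn
  obtain ⟨r, hr, hrO⟩ := Metric.nhds_basis_closedBall.mem_iff.1 (hO.mem_nhds hz)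
  obtain ⟨C, hC⟩ := ((isCompact_closedBall z r).prod hc).exists_bound_of_continuousOn
    (hF'.mono (Set.prod_mono hrO (Set.subset_univ _)))
  have hCb : Integrable fun ξ => |φ ξ| * C :=
    Integrable.mul_const ((hφ.abs : Continuous fun ξ => |φ ξ|).integrable_of_hasCompactSupport
      (hc.comp_left (g := fun x : ℝ => |x|) abs_zero)) C
  refine hasFDerivAt_integral_of_dominated_of_fderiv_le (s := Metric.closedBall z r)
    (bound := fun ξ => |φ ξ| * C) (F' := fun z ξ => φ ξ • fderiv ℝ (fun z => F z ξ) z)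
    (Metric.closedBall_mem_nhds z hr) ?_ ?_ ?_ ?_ hCb ?_
  · filter_upwards [hO.mem_nhds hz] with y hy
    exact (integrable_slice_smul hF.continuousOn hφ hc hy).2.aestronglyMeasurable
  · exact (integrable_slice_smul hF.continuousOn hφ hc hz).2
  · exact (integrable_slice_smul (G := fun z ξ => fderiv ℝ (fun z => F z ξ) z) hF' hφ hc
      hz).2.aestronglyMeasurable
  · refine .of_forall fun ξ y hy => ?_
    rw [norm_smul, Real.norm_eq_abs]
    by_cases hξ : ξ ∈ tsupport φ
    · exact mul_le_mul_of_nonneg_left (hC (y, ξ) ⟨hy, hξ⟩) (abs_nonneg _)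
    · simp [image_eq_zero_of_notMem_tsupport hξ]
  · refine .of_forall fun ξ y hy => ?_
    have h := hasFDerivAt_slice hO hF (hrO hy) ξ
    rw [h.fderiv]
    exact h.const_mul (φ ξ)

theorem fderiv_integral_slice_apply (hO : IsOpen O)
    (hF : ContDiffOn ℝ ∞ (fun p : SpaceTime N × Space N => F p.1 p.2) (O ×ˢ Set.univ))
    (hφ : Continuous φ) (hc : HasCompactSupport φ) {z : SpaceTime N} (hz : z ∈ O)
    (v : SpaceTime N) :
    fderiv ℝ (fun z => ∫ ξ, φ ξ * F z ξ) z v = ∫ ξ, φ ξ * fderiv ℝ (fun z => F z ξ) z v := by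
  rw [(hasFDerivAt_integral_slice hO hF hφ hc hz).fderiv, ContinuousLinearMap.integral_apply]
  · rfl
  · exact (integrable_slice_smul (G := fun z ξ => fderiv ℝ (fun z => F z ξ) z)
      (contDiffOn_fderiv_slice hO hF).continuousOn hφ hc hz).2

theorem contDiffOn_dx_slice (hO : IsOpen O)
    (hF : ContDiffOn ℝ ∞ (fun p : SpaceTime N × Space N => F p.1 p.2) (O ×ˢ Set.univ))
    (i : Fin N) :
    ContDiffOn ℝ ∞ (fun p : SpaceTime N × Space N => dx i (fun z => F z p.2) p.1)
      (O ×ˢ Set.univ) :=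
  (contDiffOn_fderiv_slice hO hF).clm_apply contDiffOn_const

theorem dx_integral_slice_eventuallyEq (hO : IsOpen O)
    (hF : ContDiffOn ℝ ∞ (fun p : SpaceTime N × Space N => F p.1 p.2) (O ×ˢ Set.univ))
    (hφ : Continuous φ) (hc : HasCompactSupport φ) {z : SpaceTime N} (hz : z ∈ O) (i : Fin N) :
    dx i (fun z => ∫ ξ, φ ξ * F z ξ) =ᶠ[𝓝 z] fun z => ∫ ξ, φ ξ * dx i (fun z => F z ξ) z := by
  filter_upwards [hO.mem_nhds hz] with y hy
  exact fderiv_integral_slice_apply hO hF hφ hc hy _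

theorem TwiceDifferentiableOn.integral_slice (hO : IsOpen O)
    (hF : ContDiffOn ℝ ∞ (fun p : SpaceTime N × Space N => F p.1 p.2) (O ×ˢ Set.univ))
    (hφ : Continuous φ) (hc : HasCompactSupport φ) :
    TwiceDifferentiableOn (fun z => ∫ ξ, φ ξ * F z ξ) O where
  differentiableAt _ hz := (hasFDerivAt_integral_slice hO hF hφ hc hz).differentiableAt
  differentiableAt_dx i _ hz :=
    (hasFDerivAt_integral_slice (F := fun z ξ => dx i (fun z => F z ξ) z) hO
      (contDiffOn_dx_slice hO hF i) hφ hc hz).differentiableAt.congr_of_eventuallyEq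
      (dx_integral_slice_eventuallyEq hO hF hφ hc hz i)

/-- `ℋ` may be applied under the integral sign. -/
theorem EvolutionOperator.op_integral_slice {S : TopologicalSpace.Opens (SpaceTime N)}
    (H : EvolutionOperator N S) (hO : IsOpen O)
    (hF : ContDiffOn ℝ ∞ (fun p : SpaceTime N × Space N => F p.1 p.2) (O ×ˢ Set.univ))
    (hφ : Continuous φ) (hc : HasCompactSupport φ) {z : SpaceTime N} (hz : z ∈ O) :
    H.op (fun z => ∫ ξ, φ ξ * F z ξ) z = ∫ ξ, φ ξ * H.op (fun z => F z ξ) z := by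
  have hF1 := contDiffOn_dx_slice hO hF
  have e1 : ∀ k, dx k (fun z => ∫ ξ, φ ξ * F z ξ) z = ∫ ξ, φ ξ * dx k (fun z => F z ξ) z :=
    fun k => fderiv_integral_slice_apply hO hF hφ hc hz _
  have e2 : ∀ i j, dx i (dx j fun z => ∫ ξ, φ ξ * F z ξ) z
      = ∫ ξ, φ ξ * dx i (dx j fun z => F z ξ) z := fun i j => by
    rw [((dx_integral_slice_eventuallyEq hO hF hφ hc hz j).dx i).eq_of_nhds]
    exact fderiv_integral_slice_apply hO (hF1 j) hφ hc hz _
  have e3 : dt (fun z => ∫ ξ, φ ξ * F z ξ) z = ∫ ξ, φ ξ * dt (fun z => F z ξ) z :=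
    fderiv_integral_slice_apply hO hF hφ hc hz _
  have i1 : ∀ k, Integrable fun ξ => H.b k z * (φ ξ * dx k (fun z => F z ξ) z) := fun k =>
    (integrable_slice_smul (G := fun z ξ => dx k (fun z => F z ξ) z)
      (hF1 k).continuousOn hφ hc hz).2.const_mul _
  have i2 : ∀ i j, Integrable fun ξ => H.a i j z * (φ ξ * dx i (dx j fun z => F z ξ) z) :=
    fun i j => (integrable_slice_smul (G := fun z ξ => dx i (dx j fun z => F z ξ) z)
      (contDiffOn_dx_slice (F := fun z ξ => dx j (fun z => F z ξ) z) hO (hF1 j) i).continuousOn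
      hφ hc hz).2.const_mul _
  have i3 : Integrable fun ξ => φ ξ * dt (fun z => F z ξ) z :=
    (integrable_slice_smul (G := fun z ξ => dt (fun z => F z ξ) z)
      ((contDiffOn_fderiv_slice hO hF).clm_apply contDiffOn_const).continuousOn hφ hc hz).2
  have hi2 := integrable_finsetSum Finset.univ fun i _ =>
    integrable_finsetSum Finset.univ fun j _ => i2 i j
  have hi1 := integrable_finsetSum Finset.univ fun k _ => i1 k
  simp only [op, e1, e2, e3, ← integral_const_mul]
  rw [← integral_finsetSum _ fun k _ => i1 k]
  simp_rw [← integral_finsetSum _ fun j _ => i2 _ j]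
  rw [← integral_finsetSum _ fun i _ => integrable_finsetSum _ fun j _ => i2 i j,
    ← integral_add hi2 hi1, ← integral_sub (by exact hi2.add hi1) i3]
  refine integral_congr_ae (.of_forall fun ξ => ?_)
  simp only [mul_sub, mul_add, Finset.mul_sum, mul_left_comm (φ ξ)]

end ParametricIntegral

namespace IsAdmissibleDistance

variable {d : Space N → Space N → ℝ}

theorem self_eq_zero (hd : IsAdmissibleDistance d) (x : Space N) : d x x = 0 :=
  (hd.eq_zero_iff x x).2 rfl

theorem isOpen_dBall (hd : IsAdmissibleDistance d) (x : Space N) (r : ℝ) : IsOpen (dBall d x r) :=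
  (hd.isOpen_iff _).2 fun y hy => ⟨r - d x y, sub_pos.2 hy, fun w hw => by
    have h1 := hd.triangle x y w
    simp only [dBall, Set.mem_ofPred_eq] at hw ⊢
    linarith⟩

theorem volume_dBall_lt_top (hd : IsAdmissibleDistance d) (x : Space N) (r : ℝ) :
    volume (dBall d x r) < ⊤ := by
  refine Bornology.IsBounded.measure_lt_top ?_
  rw [Bornology.isBounded_def, ← hd.comap_atTop x]
  filter_upwards [preimage_mem_comap (Ici_mem_atTop r)] with y hy
  simpa [dBall] using hy

theorem volume_real_dBall_pos (hd : IsAdmissibleDistance d) (x : Space N) {r : ℝ} (hr : 0 < r) :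
    0 < volume.real (dBall d x r) :=
  ENNReal.toReal_pos ((hd.isOpen_dBall x r).measure_pos volume
    ⟨x, by simpa [dBall, hd.self_eq_zero] using hr⟩).ne' (hd.volume_dBall_lt_top x r).ne

theorem exists_le_on_compact (hd : IsAdmissibleDistance d) (y : Space N) {K : Set (Space N)}
    (hK : IsCompact K) : ∃ M, ∀ ξ ∈ K, d y ξ ≤ M := by
  obtain ⟨n, hn⟩ := hK.elim_directed_cover (fun n : ℕ => dBall d y n)
    (fun n => hd.isOpen_dBall y n)
    (fun ξ _ => by
      obtain ⟨n, hn⟩ := exists_nat_gt (d y ξ)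
      exact Set.mem_iUnion.2 ⟨n, hn⟩)
    (directed_of_isDirected_le fun m n hmn ξ (hξ : d y ξ < m) =>
      hξ.trans_le (Nat.cast_le.2 hmn))
  exact ⟨n, fun ξ hξ => le_of_lt (hn hξ)⟩

/-- Polynomial volume growth, a consequence of the doubling property. -/
theorem exists_volume_growth (hd : IsAdmissibleDistance d) :
    ∃ Q : ℕ, ∀ (x : Space N) (r l : ℝ), 0 < r → 1 ≤ l →
      volume.real (dBall d x (l * r)) ≤ (2 * l) ^ Q * volume.real (dBall d x r) := by
  obtain ⟨c, hc, hdb⟩ := hd.doubling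
  obtain ⟨Q, hQ⟩ := pow_unbounded_of_one_lt c (one_lt_two)
  have hstep : ∀ (x : Space N) (r : ℝ), 0 < r →
      volume.real (dBall d x (2 * r)) ≤ 2 ^ Q * volume.real (dBall d x r) := fun x r hr => by
    have h := ENNReal.toReal_mono
      (ENNReal.mul_ne_top ENNReal.ofReal_ne_top (hd.volume_dBall_lt_top x r).ne) (hdb x r hr)
    rw [ENNReal.toReal_mul, ENNReal.toReal_ofReal (by linarith)] at h
    exact h.trans (mul_le_mul_of_nonneg_right hQ.le measureReal_nonneg)
  have hiter : ∀ (k : ℕ) (x : Space N) (r : ℝ), 0 < r →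
      volume.real (dBall d x (2 ^ k * r)) ≤ (2 ^ k) ^ Q * volume.real (dBall d x r) := by
    intro k x r hr
    induction k with
    | zero => simp
    | succ k ih =>
      rw [pow_succ', mul_assoc, mul_pow, mul_assoc]
      exact (hstep x _ (by positivity)).trans (mul_le_mul_of_nonneg_left ih (by positivity))
  refine ⟨Q, fun x r l hr hl => ?_⟩
  obtain ⟨k, hk1, hk2⟩ := exists_nat_pow_near hl (one_lt_two (α := ℝ))
  have hsub : dBall d x (l * r) ⊆ dBall d x (2 ^ (k + 1) * r) := fun y (hy : d x y < l * r) =>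
    hy.trans (mul_lt_mul_of_pos_right hk2 hr)
  refine (measureReal_mono hsub (hd.volume_dBall_lt_top x _).ne).trans
    ((hiter (k + 1) x r hr).trans (mul_le_mul_of_nonneg_right ?_ measureReal_nonneg))
  refine pow_le_pow_left₀ (by positivity) ?_ Q
  rw [pow_succ']
  linarith

/-- Uniform decay of the Gaussian kernels at infinity in space, down to time lag zero. -/
theorem eventually_gaussian_le (hd : IsAdmissibleDistance d) {a r₀ ε : ℝ} (ha : 0 < a)
    (hr₀ : 0 < r₀) (hε : 0 < ε) (y : Space N) (M : ℝ) :
    ∀ᶠ x in Bornology.cobounded (Space N), ∀ r, 0 < r → r ≤ r₀ → ∀ ξ, d y ξ ≤ M →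
      1 / volume.real (dBall d x r) * Real.exp (-(a * (d x ξ ^ 2 / r ^ 2))) ≤ ε := by
  obtain ⟨Q, hQ⟩ := hd.exists_volume_growth
  set m := volume.real (dBall d y r₀)
  have hm : 0 < m := hd.volume_real_dBall_pos y hr₀
  have hlim : Tendsto (fun ρ : ℝ => 4 ^ Q / m * (ρ ^ Q * Real.exp (-(a / 4) * ρ))) atTop
      (𝓝 0) := by
    have := (tendsto_rpow_mul_exp_neg_mul_atTop_nhds_zero Q (a / 4) (by positivity)).const_mul
      (4 ^ Q / m)
    simpa using this
  obtain ⟨ρ₀, hρ₀⟩ := eventually_atTop.1 (hlim.eventually_le_const hε)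
  rw [← hd.comap_atTop y]
  filter_upwards [preimage_mem_comap (Ici_mem_atTop (max (max r₀ (2 * M)) (ρ₀ * r₀)))]
    with x hx r hr hr' ξ hξ
  simp only [Set.mem_preimage, Set.mem_Ici, max_le_iff] at hx
  obtain ⟨⟨hD1, hD2⟩, hD3⟩ := hx
  set D := d y x
  set ρ := D / r with hρ
  have hDρ : D = ρ * r := (div_mul_cancel₀ _ hr.ne').symm
  have hD : 0 < D := hr₀.trans_le hD1
  have hρ1 : 1 ≤ ρ := (one_le_div hr).2 (hr'.trans hD1)
  have hρρ₀ : ρ₀ ≤ ρ := by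
    rcases le_total ρ₀ 0 with h | h
    · linarith
    · rw [hρ, le_div_iff₀ hr]
      exact (mul_le_mul_of_nonneg_left hr' h).trans hD3
  have hvol : 1 / volume.real (dBall d x r) ≤ (4 * ρ) ^ Q / m := by
    have hsub : dBall d y r₀ ⊆ dBall d x (2 * ρ * r) := fun w (hw : d y w < r₀) => by
      have h := hd.triangle x y w
      rw [hd.symm x y] at h
      change d x w < 2 * ρ * r
      linarith
    have h1 : m ≤ (4 * ρ) ^ Q * volume.real (dBall d x r) := by
      refine (measureReal_mono hsub (hd.volume_dBall_lt_top x _).ne).trans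
        ((hQ x r (2 * ρ) hr (by linarith)).trans_eq ?_)
      ring
    rw [div_le_div_iff₀ (hd.volume_real_dBall_pos x hr) hm]
    linarith
  have hdist : D / 2 ≤ d x ξ := by
    have h := hd.triangle y ξ x
    rw [hd.symm ξ x] at h
    linarith
  have hexp : a / 4 * ρ ≤ a * (d x ξ ^ 2 / r ^ 2) := by
    have h1 : (ρ / 2) ^ 2 ≤ d x ξ ^ 2 / r ^ 2 := by
      rw [← div_pow]
      refine pow_le_pow_left₀ (by positivity) ?_ 2
      rw [le_div_iff₀ hr]
      linarith
    have h2 : ρ / 4 ≤ (ρ / 2) ^ 2 := by nlinarith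
    calc a / 4 * ρ = a * (ρ / 4) := by ring
      _ ≤ _ := mul_le_mul_of_nonneg_left (h2.trans h1) ha.le
  calc 1 / volume.real (dBall d x r) * Real.exp (-(a * (d x ξ ^ 2 / r ^ 2)))
      ≤ (4 * ρ) ^ Q / m * Real.exp (-(a / 4) * ρ) := by
        refine mul_le_mul hvol (Real.exp_le_exp.2 (by linarith)) (Real.exp_pos _).le
          (by positivity)
    _ = 4 ^ Q / m * (ρ ^ Q * Real.exp (-(a / 4) * ρ)) := by rw [mul_pow]; ring
    _ ≤ ε := hρ₀ ρ hρρ₀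

theorem eventually_gaussianKernel_le (hd : IsAdmissibleDistance d) {a ε : ℝ} (ha : 0 < a)
    (hε : 0 < ε) (T : ℝ) (y : Space N) (M : ℝ) :
    ∀ᶠ x in Bornology.cobounded (Space N), ∀ t σ, t - σ ≤ T → ∀ ξ, d y ξ ≤ M →
      gaussianKernel d a (x, t) (ξ, σ) ≤ ε := by
  filter_upwards [hd.eventually_gaussian_le ha (r₀ := √(max T 1)) (by positivity) hε y M]
    with x hx t σ htσ ξ hξ
  simp only [gaussianKernel]
  split_ifs with h
  · exact hε.le
  · have hpos : 0 < t - σ := by linarith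
    have := hx (√(t - σ)) (Real.sqrt_pos.2 hpos) (Real.sqrt_le_sqrt (htσ.trans (le_max_left _ _)))
      ξ hξ
    rwa [Real.sq_sqrt hpos.le] at this

end IsAdmissibleDistance

theorem gaussianKernel_nonneg (d : Space N → Space N → ℝ) (a : ℝ) (z ζ : SpaceTime N) :
    0 ≤ gaussianKernel d a z ζ := by
  unfold gaussianKernel
  split_ifs <;> positivity

variable {T₁ T₂ : EReal} {Γ : SpaceTime N → SpaceTime N → ℝ} {d : Space N → Space N → ℝ}

theorem HasGaussianBounds.nonneg {S : TopologicalSpace.Opens (SpaceTime N)}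
    (hG : HasGaussianBounds S d Γ) {z ζ : SpaceTime N} (hz : z ∈ S) (hζ : ζ ∈ S) : 0 ≤ Γ z ζ := by
  obtain ⟨a₀, b₀, Λ, -, -, hΛ, h⟩ := hG
  exact (mul_nonneg (by positivity) (gaussianKernel_nonneg d b₀ z ζ)).trans (h z hz ζ hζ).1

/-- Under Gaussian bounds `Γ` vanishes at infinity in space, uniformly on bounded time lags and for
poles in compact sets. -/
theorem HasGaussianBounds.eventually_le (hG : HasGaussianBounds (strip N T₁ T₂) d Γ)
    (hd : IsAdmissibleDistance d) {ε : ℝ} (hε : 0 < ε) (T : ℝ) {K : Set (Space N)}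
    (hK : IsCompact K) :
    ∀ᶠ x in Bornology.cobounded (Space N), ∀ t σ : ℝ, t - σ ≤ T → ∀ ξ ∈ K,
      ((x, t) : SpaceTime N) ∈ strip N T₁ T₂ → ((ξ, σ) : SpaceTime N) ∈ strip N T₁ T₂ →
      Γ (x, t) (ξ, σ) ≤ ε := by
  obtain ⟨a₀, b₀, Λ, ha₀, -, hΛ, h⟩ := hG
  obtain ⟨M, hM⟩ := hd.exists_le_on_compact 0 hK
  have hΛ0 : 0 < Λ := by linarith
  filter_upwards [hd.eventually_gaussianKernel_le ha₀ (div_pos hε hΛ0) T 0 M]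
    with x hx t σ htσ ξ hξ hz hζ
  refine (h _ hz _ hζ).2.trans ?_
  rw [← le_div_iff₀' hΛ0]
  exact hx t σ htσ ξ (hM ξ hξ)

theorem mem_strip_of_mem {τ : ℝ} (hτ : T₁ < (τ : EReal)) {z : SpaceTime N}
    (hz : z ∈ strip N τ T₂) : z ∈ strip N T₁ T₂ :=
  ⟨hτ.trans hz.1, hz.2⟩

theorem time_ne_of_mem {τ : ℝ} {z : SpaceTime N} (hz : z ∈ strip N τ T₂) (ξ : Space N) :
    z ≠ (ξ, τ) := by
  rintro rfl
  exact lt_irrefl _ hz.1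

namespace IsFundamentalSolution

variable {H : EvolutionOperator N (strip N T₁ T₂)}

theorem contDiffOn_left (hΓ : IsFundamentalSolution H Γ) {ζ : SpaceTime N}
    (hζ : ζ ∈ strip N T₁ T₂) :
    ContDiffOn ℝ ∞ (fun z => Γ z ζ) ((strip N T₁ T₂ : Set (SpaceTime N)) \ {ζ}) :=
  hΓ.smooth.comp (f := fun z : SpaceTime N => (z, ζ)) (by fun_prop) fun _ hz => ⟨hz.1, hζ, hz.2⟩

theorem op_left_eq_zero (hΓ : IsFundamentalSolution H Γ) {z ζ : SpaceTime N}
    (hz : z ∈ strip N T₁ T₂) (hζ : ζ ∈ strip N T₁ T₂) (hne : z ≠ ζ) :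
    H.op (fun z => Γ z ζ) z = 0 := by
  refine H.op_eq_zero_of_distributional
    ((strip N T₁ T₂).isOpen.sdiff isClosed_singleton) Set.sdiff_subset
    (hΓ.contDiffOn_left hζ) (fun φ hφ => ?_) ⟨hz, hne⟩
  rw [hΓ.op_eq ζ hζ φ, image_eq_zero_of_notMem_tsupport fun h => (hφ h).2 rfl, neg_zero]

theorem contDiffOn_slice (hΓ : IsFundamentalSolution H Γ) {τ : ℝ} (hτ : T₁ < (τ : EReal))
    (hτ₂ : (τ : EReal) < T₂) :
    ContDiffOn ℝ ∞ (fun p : SpaceTime N × Space N => Γ p.1 (p.2, τ))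
      ((strip N τ T₂ : Set (SpaceTime N)) ×ˢ Set.univ) :=
  hΓ.smooth.comp (f := fun p : SpaceTime N × Space N => (p.1, ((p.2, τ) : SpaceTime N)))
    (by fun_prop) fun p hp => ⟨mem_strip_of_mem hτ hp.1, ⟨hτ, hτ₂⟩, time_ne_of_mem hp.1 p.2⟩

/-- If the compactly supported datum `φ` is `ε`-close from below to `Γ(·, τ; y, s)`, the solution
with datum `φ` at time `τ` is `ε`-close to `Γ(·; y, s)`. -/
theorem abs_sub_integral_le (hΓ : IsFundamentalSolution H Γ) (hd : IsAdmissibleDistance d)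
    (hG : HasGaussianBounds (strip N T₁ T₂) d Γ) {t τ s ε : ℝ} (hs : T₁ < (s : EReal))
    (hsτ : s < τ) (hτt : τ < t) (ht : (t : EReal) < T₂) (hε : 0 < ε) (x y : Space N)
    {φ : Space N → ℝ} (hφ : Continuous φ) (hc : HasCompactSupport φ) (hφ0 : ∀ ξ, 0 ≤ φ ξ)
    (hle : ∀ ξ, φ ξ ≤ Γ (ξ, τ) (y, s)) (hge : ∀ ξ, Γ (ξ, τ) (y, s) - φ ξ ≤ ε) :
    |Γ (x, t) (y, s) - ∫ ξ, φ ξ * Γ (x, t) (ξ, τ)| ≤ ε := by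
  have hτ : T₁ < (τ : EReal) := hs.trans (EReal.coe_lt_coe_iff.2 hsτ)
  have hτ₂ : (τ : EReal) < T₂ := (EReal.coe_lt_coe_iff.2 hτt).trans ht
  have hζ : ((y, s) : SpaceTime N) ∈ strip N T₁ T₂ :=
    ⟨hs, (EReal.coe_lt_coe_iff.2 hsτ).trans hτ₂⟩
  have hξS : ∀ ξ, ((ξ, τ) : SpaceTime N) ∈ strip N T₁ T₂ := fun ξ => ⟨hτ, hτ₂⟩
  have hS : ∀ z ∈ strip N τ T₂, z ∈ strip N T₁ T₂ := fun z => mem_strip_of_mem hτ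
  have hne : ∀ z : SpaceTime N, s < z.2 → z ≠ (y, s) := by
    rintro z hz rfl
    exact lt_irrefl _ hz
  have hsz : ∀ z ∈ strip N τ T₂, s < z.2 := fun z hz => hsτ.trans (EReal.coe_lt_coe_iff.1 hz.1)
  have hO := (strip N τ T₂).isOpen
  have hF := hΓ.contDiffOn_slice hτ hτ₂
  set u : SpaceTime N → ℝ := fun z => Γ z (y, s) with hu_def
  set v : SpaceTime N → ℝ := fun z => ∫ ξ, φ ξ * Γ z (ξ, τ) with hv_def
  have hu : TwiceDifferentiableOn u (strip N τ T₂) := .of_contDiffOn hO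
    ((hΓ.contDiffOn_left hζ).mono fun z hz => ⟨hS z hz, hne z (hsz z hz)⟩)
  have hv : TwiceDifferentiableOn v (strip N τ T₂) := .integral_slice hO hF hφ hc
  have hopu : ∀ z ∈ strip N τ T₂, H.op u z = 0 := fun z hz =>
    hΓ.op_left_eq_zero (hS z hz) hζ (hne z (hsz z hz))
  have hopv : ∀ z ∈ strip N τ T₂, H.op v z = 0 := fun z hz => by
    rw [H.op_integral_slice (F := fun z ξ => Γ z (ξ, τ)) hO hF hφ hc hz]
    simp [hΓ.op_left_eq_zero (hS z hz) (hξS _) (time_ne_of_mem hz _)]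
  have hlim : ∀ x₀, Tendsto (fun p => u p - v p) (𝓝 x₀ ×ˢ 𝓝[>] τ)
      (𝓝 (Γ (x₀, τ) (y, s) - φ x₀)) := fun x₀ => by
    refine Tendsto.sub ?_ ?_
    · have hcont : ContinuousAt u (x₀, τ) :=
        ((hΓ.contDiffOn_left hζ).contDiffAt (((strip N T₁ T₂).isOpen.sdiff
          isClosed_singleton).mem_nhds ⟨hξS x₀, hne _ hsτ⟩)).continuousAt
      refine hcont.tendsto.mono_left ?_
      rw [nhds_prod_eq]
      exact prod_mono le_rfl nhdsWithin_le_nhds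
    · have := hΓ.tendsto_forward φ hφ hc x₀ τ hτ hτ₂
      simpa only [mul_comm] using this
  have hmem : ∀ {x' : Space N} {t' : ℝ}, t' ∈ Set.Ioc τ t → ((x', t') : SpaceTime N) ∈ strip N τ T₂ :=
    fun {x' t'} h => ⟨EReal.coe_lt_coe_iff.2 h.1, (EReal.coe_le_coe_iff.2 h.2).trans_lt ht⟩
  have hv0 : ∀ z ∈ strip N τ T₂, 0 ≤ v z := fun z hz =>
    integral_nonneg fun ξ => mul_nonneg (hφ0 ξ) (hG.nonneg (hS z hz) (hξS ξ))
  have hinfu : ∀ᶠ x' in Bornology.cobounded (Space N), ∀ t' ∈ Set.Ioc τ t, u (x', t') ≤ ε := by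
    filter_upwards [hG.eventually_le hd hε (t - s) (isCompact_singleton (x := y))] with x' hx' t' ht'
    exact hx' t' s (by linarith [ht'.2]) y rfl (hS _ (hmem ht')) hζ
  have hinfv : ∀ᶠ x' in Bornology.cobounded (Space N), ∀ t' ∈ Set.Ioc τ t, v (x', t') ≤ ε := by
    have hφi : 0 ≤ ∫ ξ, φ ξ := integral_nonneg hφ0
    filter_upwards [hG.eventually_le hd (ε := ε / ((∫ ξ, φ ξ) + 1)) (by positivity) (t - τ) hc]
      with x' hx' t' ht'
    calc v (x', t') ≤ ∫ ξ, φ ξ * (ε / ((∫ ξ, φ ξ) + 1)) := by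
          refine integral_mono
            (integrable_slice_smul (G := fun z ξ => Γ z (ξ, τ)) hF.continuousOn hφ hc (hmem ht')).2
            ((hφ.integrable_of_hasCompactSupport hc).mul_const _) fun ξ => ?_
          by_cases hξ : ξ ∈ tsupport φ
          · exact mul_le_mul_of_nonneg_left
              (hx' t' τ (by linarith [ht'.2]) ξ hξ (hS _ (hmem ht')) (hξS ξ)) (hφ0 ξ)
          · simp [image_eq_zero_of_notMem_tsupport hξ]
      _ = ε * ((∫ ξ, φ ξ) / ((∫ ξ, φ ξ) + 1)) := by rw [integral_mul_const]; ring
      _ ≤ ε := mul_le_of_le_one_right hε.le ((div_le_one (by positivity)).2 (by linarith))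
  rw [abs_sub_le_iff]
  constructor
  · refine weak_maximum_principle (W := fun z => u z - v z) H hτ.le ht (hu.sub hO hv)
      (fun z hz => ?_) (fun x₀ c hcε => ?_) ?_ x ⟨hτt, le_rfl⟩
    · rw [H.op_sub hO hu hv hz, hopu z hz, hopv z hz, sub_zero]
    · exact (hlim x₀).eventually_le_const ((hge x₀).trans_lt hcε)
    · filter_upwards [hinfu] with x' hx' t' ht'
      linarith [hx' t' ht', hv0 _ (hmem (x' := x') ht')]
  · refine weak_maximum_principle (W := fun z => v z - u z) H hτ.le ht (hv.sub hO hu)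
      (fun z hz => ?_) (fun x₀ c hcε => ?_) ?_ x ⟨hτt, le_rfl⟩
    · rw [H.op_sub hO hv hu hz, hopu z hz, hopv z hz, sub_zero]
    · have h := (hlim x₀).neg
      simp only [neg_sub] at h
      exact h.eventually_le_const (by linarith [hle x₀])
    · filter_upwards [hinfv] with x' hx' t' ht'
      linarith [hx' t' ht', hG.nonneg (hS _ (hmem (x' := x') ht')) hζ]

end IsFundamentalSolution

/-- A radial continuous cutoff, equal to `1` for `‖ξ‖ ≤ n` and to `0` for `‖ξ‖ ≥ n + 1`. -/
noncomputable def radialCutoff (n : ℕ) (ξ : Space N) : ℝ := max 0 (min 1 (n + 1 - ‖ξ‖))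

theorem continuous_radialCutoff (n : ℕ) : Continuous (radialCutoff (N := N) n) := by
  unfold radialCutoff
  fun_prop

theorem radialCutoff_nonneg (n : ℕ) (ξ : Space N) : 0 ≤ radialCutoff n ξ := le_max_left _ _

theorem radialCutoff_le_one (n : ℕ) (ξ : Space N) : radialCutoff n ξ ≤ 1 :=
  max_le zero_le_one (min_le_left _ _)

theorem radialCutoff_eq_one {n : ℕ} {ξ : Space N} (h : ‖ξ‖ ≤ n) : radialCutoff n ξ = 1 := by
  rw [radialCutoff, min_eq_left (by linarith), max_eq_right zero_le_one]

theorem hasCompactSupport_radialCutoff (n : ℕ) : HasCompactSupport (radialCutoff (N := N) n) :=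
  HasCompactSupport.intro (isCompact_closedBall 0 (n + 1)) fun ξ hξ => by
    have : (n : ℝ) + 1 < ‖ξ‖ := by simpa using hξ
    exact max_eq_left ((min_le_right _ _).trans (by linarith))

/-- Fatou's lemma with dominated convergence: if `0 ≤ g n ≤ g`, `g n → g` pointwise and the
integrals of `g n` converge, then `g` is integrable and its integral is the limit. -/
theorem integrable_and_integral_eq_of_tendsto {α : Type*} [MeasurableSpace α] {μ : Measure α}
    {g : ℕ → α → ℝ} {G : α → ℝ} {L : ℝ} (hgi : ∀ n, Integrable (g n) μ)
    (hG : AEStronglyMeasurable G μ) (h0 : ∀ n a, 0 ≤ g n a) (hle : ∀ n a, g n a ≤ G a)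
    (hlim : ∀ a, Tendsto (fun n => g n a) atTop (𝓝 (G a)))
    (hL : Tendsto (fun n => ∫ a, g n a ∂μ) atTop (𝓝 L)) :
    Integrable G μ ∧ L = ∫ a, G a ∂μ := by
  have hG0 : ∀ a, 0 ≤ G a := fun a => (h0 0 a).trans (hle 0 a)
  have hint : Integrable G μ := by
    refine ⟨hG, ?_⟩
    rw [hasFiniteIntegral_iff_ofReal (.of_forall hG0)]
    calc ∫⁻ a, ENNReal.ofReal (G a) ∂μ
        = ∫⁻ a, liminf (fun n => ENNReal.ofReal (g n a)) atTop ∂μ :=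
          lintegral_congr fun a =>
            ((ENNReal.continuous_ofReal.tendsto _).comp (hlim a)).liminf_eq.symm
      _ ≤ liminf (fun n => ∫⁻ a, ENNReal.ofReal (g n a) ∂μ) atTop :=
          lintegral_liminf_le' fun n => (hgi n).aemeasurable.ennreal_ofReal
      _ = ENNReal.ofReal L := by
          simp_rw [← ofReal_integral_eq_lintegral_ofReal (hgi _) (.of_forall (h0 _))]
          exact ((ENNReal.continuous_ofReal.tendsto _).comp hL).liminf_eq
      _ < ⊤ := ENNReal.ofReal_lt_top
  refine ⟨hint, tendsto_nhds_unique hL ?_⟩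
  refine tendsto_integral_of_dominated_convergence G (fun n => (hgi n).aestronglyMeasurable) hint
    (fun n => .of_forall fun a => ?_) (.of_forall hlim)
  rw [Real.norm_of_nonneg (h0 n a)]
  exact hle n a

end EvolutionOperators

theorem mainTheorem3 (N : ℕ) (T₁ T₂ : EReal) (hT : T₁ < T₂)
    (H : EvolutionOperators.EvolutionOperator N (EvolutionOperators.strip N T₁ T₂))
    (hH : H.Hypoelliptic) (hH' : H.AdjointHypoelliptic)
    (Γ : EvolutionOperators.SpaceTime N → EvolutionOperators.SpaceTime N → ℝ)
    (hΓ : EvolutionOperators.IsFundamentalSolution H Γ)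
    (d : EvolutionOperators.Space N → EvolutionOperators.Space N → ℝ)
    (hd : EvolutionOperators.IsAdmissibleDistance d)
    (hG : EvolutionOperators.HasGaussianBounds (EvolutionOperators.strip N T₁ T₂) d Γ)
    (x y : EvolutionOperators.Space N) (t τ s : ℝ)
    (hs : T₁ < (s : EReal)) (hsτ : s < τ) (hτt : τ < t) (ht : (t : EReal) < T₂) :
    MeasureTheory.Integrable
        (fun ξ : EvolutionOperators.Space N => Γ (x, t) (ξ, τ) * Γ (ξ, τ) (y, s)) ∧
      Γ (x, t) (y, s) = ∫ ξ : EvolutionOperators.Space N, Γ (x, t) (ξ, τ) * Γ (ξ, τ) (y, s) := by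
  open EvolutionOperators in
  have hτ : T₁ < (τ : EReal) := hs.trans (EReal.coe_lt_coe_iff.2 hsτ)
  have hτ₂ : (τ : EReal) < T₂ := (EReal.coe_lt_coe_iff.2 hτt).trans ht
  have hζ : ((y, s) : SpaceTime N) ∈ strip N T₁ T₂ :=
    ⟨hs, (EReal.coe_lt_coe_iff.2 hsτ).trans hτ₂⟩
  have hξS : ∀ ξ, ((ξ, τ) : SpaceTime N) ∈ strip N T₁ T₂ := fun ξ => ⟨hτ, hτ₂⟩
  have hzO : ((x, t) : SpaceTime N) ∈ strip N τ T₂ := ⟨EReal.coe_lt_coe_iff.2 hτt, ht⟩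
  have hzS : ((x, t) : SpaceTime N) ∈ strip N T₁ T₂ := ⟨hτ.trans hzO.1, ht⟩
  set f : Space N → ℝ := fun ξ => Γ (ξ, τ) (y, s) with hf_def
  have hf0 : ∀ ξ, 0 ≤ f ξ := fun ξ => hG.nonneg (hξS ξ) hζ
  have hfc : Continuous f :=
    (hΓ.contDiffOn_left hζ).continuousOn.comp_continuous (f := fun ξ => ((ξ, τ) : SpaceTime N))
      (by fun_prop) fun ξ => ⟨hξS ξ, fun h => hsτ.ne' (Prod.ext_iff.1 h).2⟩
  set φ : ℕ → Space N → ℝ := fun n ξ => radialCutoff n ξ * f ξ with hφ_def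
  have hφc : ∀ n, Continuous (φ n) := fun n => (continuous_radialCutoff n).mul hfc
  have hφs : ∀ n, HasCompactSupport (φ n) := fun n => (hasCompactSupport_radialCutoff n).mul_right
  have hφ0 : ∀ n ξ, 0 ≤ φ n ξ := fun n ξ => mul_nonneg (radialCutoff_nonneg n ξ) (hf0 ξ)
  have hφf : ∀ n ξ, φ n ξ ≤ f ξ := fun n ξ =>
    mul_le_of_le_one_left (hf0 ξ) (radialCutoff_le_one n ξ)
  have hslice := fun n => integrable_slice_smul (G := fun z ξ => Γ z (ξ, τ))
    (hΓ.contDiffOn_slice hτ hτ₂).continuousOn (hφc n) (hφs n) hzO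
  have hΓ0 : ∀ ξ, 0 ≤ Γ (x, t) (ξ, τ) := fun ξ => hG.nonneg hzS (hξS ξ)
  have hL : Tendsto (fun n => ∫ ξ, φ n ξ * Γ (x, t) (ξ, τ)) atTop (𝓝 (Γ (x, t) (y, s))) := by
    rw [Metric.tendsto_atTop']
    intro ε hε
    have hinf := hG.eventually_le hd (half_pos hε) (τ - s) (isCompact_singleton (x := y))
    obtain ⟨R, -, hR⟩ :=
      (Metric.hasBasis_cobounded_compl_closedBall (0 : Space N)).eventually_iff.1 hinf
    obtain ⟨n₀, hn₀⟩ := exists_nat_ge R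
    refine ⟨n₀, fun n hn => ?_⟩
    rw [dist_comm, Real.dist_eq]
    refine (hΓ.abs_sub_integral_le hd hG hs hsτ hτt ht (half_pos hε) x y (hφc n) (hφs n) (hφ0 n)
      (hφf n) fun ξ => ?_).trans_lt (half_lt_self hε)
    by_cases hξ : ‖ξ‖ ≤ n
    · simp only [hφ_def, hf_def, radialCutoff_eq_one hξ, one_mul, sub_self]
      positivity
    · have hRξ : ξ ∈ (Metric.closedBall (0 : Space N) R)ᶜ := by
        have : (n₀ : ℝ) ≤ n := Nat.cast_le.2 hn.le
        simp only [Set.mem_compl_iff, mem_closedBall_zero_iff, not_le] at hξ ⊢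
        linarith
      have := hR hRξ τ s le_rfl y rfl (hξS ξ) hζ
      linarith [hφ0 n ξ]
  have key := integrable_and_integral_eq_of_tendsto (fun n => (hslice n).2)
    (((hslice 0).1.mul hfc).aestronglyMeasurable)
    (fun n ξ => mul_nonneg (hφ0 n ξ) (hΓ0 ξ))
    (fun n ξ => (mul_le_mul_of_nonneg_right (hφf n ξ) (hΓ0 ξ)).trans_eq (mul_comm _ _))
    (fun ξ => ?_) hL
  · exact key
  · refine tendsto_const_nhds.congr' ?_
    obtain ⟨n₀, hn₀⟩ := exists_nat_ge ‖ξ‖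
    filter_upwards [eventually_ge_atTop n₀] with n hn
    have : ‖ξ‖ ≤ n := hn₀.trans (Nat.cast_le.2 hn)
    simp [hφ_def, radialCutoff_eq_one this, mul_comm]
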